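/- All graphs are finite and simple. For graphs $G$ and $H$, an $H$-model of $G$ is a map $f : V(G) \to V(H)$ such that for each $i \in V(H)$ the branch set $G(f,i)$, i.e. the subgraph of $G$ induced by $f^{-1}(i)$, is nonempty and connected, and for each edge $ij \in E(H)$ there is an edge of $G$ joining a vertex of $G(f,i)$ to a vertex of $G(f,j)$; we call $f(v)$ the label of $v$. The reconfiguration graph of $G$ and $H$ has the $H$-models of $G$ as its nodes, two of them being adjacent if they differ in the label of exactly one vertex of $G$. A model $f$ can be reconfigured to a model $g$ if there is a path from $f$ to $g$ in the reconfiguration graph. Let $\mathrm{host}(H)$ be the set of graphs $G$ that have at least one $H$-model and whose reconfiguration graph with respect to $H$ is connected. An edge $xy$ of $G$ is an essential edge under the model $f$ if $f(x)f(y) \in E(H)$ and $xy$ is the only edge of $G$ between $G(f,f(x))$ and $G(f,f(y))$. A graph is $k$-connected if it has more than $k$ vertices and remains connected after the deletion of any set of fewer than $k$ vertices. **Lemma.** Let $G$ be a $4$-connected graph with $|V(G)| \ge 5$ and $G \in \mathrm{host}(K_4)$, let $f$ be a $K_4$-model of $G$, and let $xy$ be an essential edge under $f$. Then $f$ can be reconfigured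 to a $K_4$-model $g$ of $G$ with $g(x) = g(y)$. -/

import Mathlib

namespace MinorReconfiguration

/-- `G` is `k`-connected: it has more than `k` vertices, and deleting fewer than `k` vertices
never disconnects it (no cut set has fewer than `k` vertices). -/
def IsKConnected {V : Type*} [Fintype V] (k : ℕ) (G : SimpleGraph V) : Prop :=
  k < Fintype.card V ∧ ∀ S : Finset V, S.card < k → (G.induce {v | v ∉ S}).Connected

/-- The branch set `G(f, i)`: the subgraph of `G` induced on the vertices with label `i`. -/
def branchSet {V W : Type*} (G : SimpleGraph V) (f : V → W) (i : W) :
    SimpleGraph {v : V | f v = i} :=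
  G.induce {v : V | f v = i}

/-- `f` is an `H`-model of `G`: every branch set is nonempty and connected, and every edge
`ij` of `H` is realised by an edge of `G` between the branch sets of `i` and `j`.
(`SimpleGraph.Connected` includes nonemptiness.) -/
structure IsModel {V W : Type*} (G : SimpleGraph V) (H : SimpleGraph W) (f : V → W) : Prop where
  connected : ∀ i : W, (branchSet G f i).Connected
  edges : ∀ i j : W, H.Adj i j → ∃ u v : V, f u = i ∧ f v = j ∧ G.Adj u v

/-- The type of `H`-models of `G`. -/
def Model {V W : Type*} (G : SimpleGraph V) (H : SimpleGraph W) : Type _ :=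
  {f : V → W // IsModel G H f}

/-- The label of a vertex under a model. -/
def Model.label {V W : Type*} {G : SimpleGraph V} {H : SimpleGraph W} (f : Model G H) : V → W :=
  f.1

/-- The reconfiguration graph: its nodes are the `H`-models of `G`, and two nodes are adjacent
when they differ in the label of exactly one vertex of `G`. -/
def reconfGraph {V W : Type*} (G : SimpleGraph V) (H : SimpleGraph W) :
    SimpleGraph (Model G H) where
  Adj f g := ∃! v : V, f.label v ≠ g.label v
  symm := ⟨fun _ _ ⟨v, hv, hu⟩ => ⟨v, Ne.symm hv, fun u h => hu u (Ne.symm h)⟩⟩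
  loopless := ⟨fun _ ⟨_, hv, _⟩ => hv rfl⟩

/-- `f` can be reconfigured to `g`: the reconfiguration graph has a path from `f` to `g`. -/
def Reconfigurable {V W : Type*} {G : SimpleGraph V} {H : SimpleGraph W}
    (f g : Model G H) : Prop :=
  (reconfGraph G H).Reachable f g

/-- `host H`: the graphs (on the vertex type `V`) having `H` as a minor and whose
reconfiguration graph with respect to `H` is connected.
(`SimpleGraph.Connected` includes nonemptiness, that is, the existence of an `H`-model.) -/
def host {V W : Type*} (H : SimpleGraph W) : Set (SimpleGraph V) :=
  {G | (reconfGraph G H).Connected}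

/-- `xy` is an essential edge under the model `f`: it is an edge of `G` between two branch sets
whose labels are adjacent in `H`, and it is the only edge of `G` between these branch sets. -/
def IsEssentialEdge {V W : Type*} {G : SimpleGraph V} {H : SimpleGraph W}
    (f : Model G H) (x y : V) : Prop :=
  G.Adj x y ∧ H.Adj (f.label x) (f.label y) ∧
    ∀ u v : V, G.Adj u v → f.label u = f.label x → f.label v = f.label y → u = x ∧ v = y

/-- The complete graph on four vertices. -/
abbrev K₄ : SimpleGraph (Fin 4) := ⊤

end MinorReconfiguration

namespace MinorReconfiguration

open SimpleGraph

/-! Since the reconfiguration graph is connected, it suffices to find one `K₄`-model with `x` and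
`y` in the same branch set. Take `{x, y}` as that branch set. By 4-connectivity, `x` has three
neighbours `a`, `b`, `c` other than `y`, and the complement of `{x, y}` stays connected when any one
further vertex is deleted. Such a set has a partition into three connected, pairwise touching parts
rooted at `a`, `b`, `c` (`hasRootedTriangle`). Each part touches `x` at its root, so the three parts
complete the model. -/

variable {V : Type*}

/-! ### Connectedness of vertex sets through cuts -/

/-- Some edge of `G` joins a vertex of `A` to a vertex of `B`. -/
def Touches (G : SimpleGraph V) (A B : Set V) : Prop :=
  ∃ u ∈ A, ∃ v ∈ B, G.Adj u v

lemma Touches.symm {G : SimpleGraph V} {A B : Set V} (h : Touches G A B) : Touches G B A := by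
  obtain ⟨u, hu, v, hv, huv⟩ := h
  exact ⟨v, hv, u, hu, huv.symm⟩

lemma Touches.mono {G : SimpleGraph V} {A B A' B' : Set V} (h : Touches G A B) (hA : A ⊆ A')
    (hB : B ⊆ B') : Touches G A' B' := by
  obtain ⟨u, hu, v, hv, huv⟩ := h
  exact ⟨u, hA hu, v, hB hv, huv⟩

/-- A nonempty vertex set all of whose cuts are crossed by an edge of `G`. -/
def IsConnSet (G : SimpleGraph V) (X : Set V) : Prop :=
  X.Nonempty ∧ ∀ T ⊆ X, T.Nonempty → (X \ T).Nonempty → Touches G T (X \ T)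

lemma isConnSet_iff {G : SimpleGraph V} {X : Set V} :
    IsConnSet G X ↔ (G.induce X).Connected := by
  constructor
  · rintro ⟨⟨x, hx⟩, h⟩
    have key : ∀ v : X, (G.induce X).Reachable ⟨x, hx⟩ v := by
      by_contra! hcon
      obtain ⟨w, hw⟩ := hcon
      let T : Set V := {v | ∃ hv : v ∈ X, (G.induce X).Reachable ⟨x, hx⟩ ⟨v, hv⟩}
      obtain ⟨u, ⟨huX, hu⟩, v, ⟨hvX, hv⟩, huv⟩ := h T (fun v hv => hv.1) ⟨x, hx, Reachable.rfl⟩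
        ⟨w, w.2, fun h => hw h.2⟩
      have hadj : (G.induce X).Adj ⟨u, huX⟩ ⟨v, hvX⟩ := huv
      exact hv ⟨hvX, hu.trans hadj.reachable⟩
    exact { preconnected := fun u v => (key u).symm.trans (key v), nonempty := ⟨⟨x, hx⟩⟩ }
  · intro h
    obtain ⟨x⟩ := h.nonempty
    refine ⟨⟨x, x.2⟩, ?_⟩
    rintro T hT ⟨u, hu⟩ ⟨v, hvX, hvT⟩
    obtain ⟨p⟩ := h.preconnected ⟨u, hT hu⟩ ⟨v, hvX⟩
    obtain ⟨e, -, he1, he2⟩ := p.exists_boundary_dart {z | (z : V) ∈ T} hu hvT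
    exact ⟨e.fst, he1, e.snd, ⟨e.snd.2, he2⟩, e.adj⟩

/-- It suffices to check the cuts on the side that contains (or avoids) a given vertex. -/
lemma isConnSet_of_mem {G : SimpleGraph V} {X : Set V} {x : V} (hx : x ∈ X)
    (h : ∀ T ⊆ X, x ∈ T → (X \ T).Nonempty → Touches G T (X \ T)) : IsConnSet G X := by
  refine ⟨⟨x, hx⟩, fun T hT hne hne' => ?_⟩
  by_cases hxT : x ∈ T
  · exact h T hT hxT hne'
  · have hdd : X \ (X \ T) = T := Set.sdiff_sdiff_cancel_left hT
    have := h (X \ T) Set.sdiff_subset ⟨hx, hxT⟩ (by rwa [hdd])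
    rw [hdd] at this
    exact this.symm

lemma isConnSet_singleton (G : SimpleGraph V) (x : V) : IsConnSet G {x} := by
  refine isConnSet_of_mem rfl fun T _ hx hne => ?_
  obtain ⟨v, rfl, hv⟩ := hne
  exact absurd hx hv

lemma IsConnSet.union {G : SimpleGraph V} {A B : Set V} (hA : IsConnSet G A)
    (hB : IsConnSet G B) (h : Touches G A B) : IsConnSet G (A ∪ B) := by
  obtain ⟨u, hu, v, hv, huv⟩ := h
  refine isConnSet_of_mem (Or.inl hu) fun T _ huT hne => ?_
  by_cases hAT : A ⊆ T
  · by_cases hvT : v ∈ T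
    · obtain ⟨w, hw, hwT⟩ := hne
      have hwB : w ∈ B := hw.resolve_left fun h => hwT (hAT h)
      refine (hB.2 (B ∩ T) Set.inter_subset_left ⟨v, hv, hvT⟩ ⟨w, hwB, fun h => hwT h.2⟩).mono
        Set.inter_subset_right ?_
      exact fun z hz => ⟨Or.inr hz.1, fun h => hz.2 ⟨hz.1, h⟩⟩
    · exact ⟨u, huT, v, ⟨Or.inr hv, hvT⟩, huv⟩
  · obtain ⟨w, hwA, hwT⟩ := Set.not_subset.1 hAT
    refine (hA.2 (A ∩ T) Set.inter_subset_left ⟨u, hu, huT⟩ ⟨w, hwA, fun h => hwT h.2⟩).mono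
      Set.inter_subset_right ?_
    exact fun z hz => ⟨Or.inl hz.1, fun h => hz.2 ⟨hz.1, h⟩⟩

/-! ### Splitting a connected set at a vertex -/

/-- The vertices that can be reached from `b` inside `X` without using `d`. -/
def reachAvoiding (G : SimpleGraph V) (X : Set V) (b d : V) : Set V :=
  {v | Relation.ReflTransGen (fun u w => G.Adj u w ∧ w ∈ X ∧ w ≠ d) b v}

section reachAvoiding

variable {G : SimpleGraph V} {X : Set V} {b d e : V}

lemma mem_reachAvoiding_self : b ∈ reachAvoiding G X b d := Relation.ReflTransGen.refl

lemma mem_reachAvoiding_of_adj {u w : V} (hu : u ∈ reachAvoiding G X b d) (huw : G.Adj u w)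
    (hw : w ∈ X) (hwd : w ≠ d) : w ∈ reachAvoiding G X b d :=
  Relation.ReflTransGen.tail hu ⟨huw, hw, hwd⟩

lemma reachAvoiding_subset (hb : b ∈ X) (hbd : b ≠ d) : reachAvoiding G X b d ⊆ X \ {d} := by
  intro v hv
  induction hv with
  | refl => exact ⟨hb, hbd⟩
  | tail _ h _ => exact ⟨h.2.1, h.2.2⟩

lemma isConnSet_reachAvoiding : IsConnSet G (reachAvoiding G X b d) := by
  refine isConnSet_of_mem mem_reachAvoiding_self fun T _ hbT ⟨w, hw, hwT⟩ => ?_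
  by_contra hcon
  refine hwT ?_
  clear hwT
  induction hw with
  | refl => exact hbT
  | tail h1 h2 ih =>
    by_contra hT
    exact hcon ⟨_, ih, _, ⟨mem_reachAvoiding_of_adj h1 h2.1 h2.2.1 h2.2.2, hT⟩, h2.1⟩

/-- A vertex of the remainder other than `d` has no neighbour in the reachable set, so the side of a
cut that misses `d` can only be left towards the rest of the remainder. -/
lemma IsConnSet.diff_reachAvoiding (hX : IsConnSet G X) (hb : b ∈ X) (hd : d ∈ X) (hbd : b ≠ d) :
    IsConnSet G (X \ reachAvoiding G X b d) := by
  have hdR : d ∉ reachAvoiding G X b d := fun h => (reachAvoiding_subset hb hbd h).2 rfl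
  refine isConnSet_of_mem ⟨hd, hdR⟩ fun T hT hdT ⟨w, hw, hwT⟩ => ?_
  obtain ⟨u, ⟨⟨huX, huR⟩, huT⟩, v, ⟨hvX, hv⟩, huv⟩ :=
    hX.2 ((X \ reachAvoiding G X b d) \ T) (fun z hz => hz.1.1) ⟨w, hw, hwT⟩
      ⟨d, hd, fun h => h.2 hdT⟩
  have hud : u ≠ d := fun h => huT (h ▸ hdT)
  have hvR : v ∉ reachAvoiding G X b d := fun h =>
    huR (mem_reachAvoiding_of_adj h huv.symm huX hud)
  have hvT : v ∈ T := by
    by_contra h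
    exact hv ⟨⟨hvX, hvR⟩, h⟩
  exact ⟨v, hvT, u, ⟨⟨huX, huR⟩, huT⟩, huv.symm⟩

lemma IsConnSet.touches_reachAvoiding (hX : IsConnSet G X) (hb : b ∈ X) (hd : d ∈ X)
    (hbd : b ≠ d) : Touches G (reachAvoiding G X b d) (X \ reachAvoiding G X b d) :=
  hX.2 _ ((reachAvoiding_subset hb hbd).trans Set.sdiff_subset) ⟨b, mem_reachAvoiding_self⟩
    ⟨d, hd, fun h => (reachAvoiding_subset hb hbd h).2 rfl⟩

/-- Two distinct vertices of a connected set cannot separate each other from `b`. -/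
lemma IsConnSet.mem_reachAvoiding_or (hX : IsConnSet G X) (hb : b ∈ X) (hd : d ∈ X)
    (hbd : b ≠ d) (hde : d ≠ e) :
    e ∈ reachAvoiding G X b d ∨ d ∈ reachAvoiding G X b e := by
  by_contra! hcon
  -- If no walk from `b` avoiding `d` meets `e`, these walks also avoid `e`. An edge leaving the set
  -- they reach must end at `d`, so `d` is reached while avoiding `e`.
  have hsub : reachAvoiding G X b d ⊆ reachAvoiding G X b e := by
    intro v hv
    induction hv with
    | refl => exact mem_reachAvoiding_self
    | tail h1 h2 ih =>
      refine mem_reachAvoiding_of_adj ih h2.1 h2.2.1 ?_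
      rintro rfl
      exact hcon.1 (mem_reachAvoiding_of_adj h1 h2.1 h2.2.1 h2.2.2)
  obtain ⟨u, hu, v, ⟨hvX, hv⟩, huv⟩ := hX.touches_reachAvoiding hb hd hbd
  by_cases hvd : v = d
  · subst hvd
    exact hcon.2 (mem_reachAvoiding_of_adj (hsub hu) huv hd hde)
  · exact hv (mem_reachAvoiding_of_adj hu huv hvX hvd)

end reachAvoiding

/-! ### Rooted triangle minors -/

/-- `A`, `B`, `C` partition `S` into connected sets that contain `a`, `b`, `c` respectively. -/
structure IsRootedPartition (G : SimpleGraph V) (S : Set V) (a b c : V) (A B C : Set V) :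
    Prop where
  connA : IsConnSet G A
  connB : IsConnSet G B
  connC : IsConnSet G C
  memA : a ∈ A
  memB : b ∈ B
  memC : c ∈ C
  disjAB : Disjoint A B
  disjAC : Disjoint A C
  disjBC : Disjoint B C
  union : A ∪ B ∪ C = S

/-- `S` has a partition into three connected, pairwise touching sets rooted at `a`, `b`, `c`. -/
def HasRootedTriangle (G : SimpleGraph V) (S : Set V) (a b c : V) : Prop :=
  ∃ A B C, IsRootedPartition G S a b c A B C ∧ Touches G A B ∧ Touches G A C ∧ Touches G B C

section rooted

variable {G : SimpleGraph V} {S A B C : Set V} {a b c d : V}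

lemma IsRootedPartition.reverse (h : IsRootedPartition G S a b c A B C) :
    IsRootedPartition G S c b a C B A where
  connA := h.connC
  connB := h.connB
  connC := h.connA
  memA := h.memC
  memB := h.memB
  memC := h.memA
  disjAB := h.disjBC.symm
  disjAC := h.disjAC.symm
  disjBC := h.disjAB.symm
  union := by rw [← h.union]; ext; simp; tauto

lemma IsRootedPartition.swap (h : IsRootedPartition G S a b c A B C) :
    IsRootedPartition G S a c b A C B where
  connA := h.connA
  connB := h.connC
  connC := h.connB
  memA := h.memA
  memB := h.memC
  memC := h.memB
  disjAB := h.disjAC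
  disjAC := h.disjAB
  disjBC := h.disjBC.symm
  union := by rw [← h.union]; ext; simp; tauto

lemma HasRootedTriangle.reverse (h : HasRootedTriangle G S a b c) :
    HasRootedTriangle G S c b a := by
  obtain ⟨A, B, C, h, hAB, hAC, hBC⟩ := h
  exact ⟨C, B, A, h.reverse, hBC.symm, hAC.symm, hAB.symm⟩

lemma HasRootedTriangle.swap (h : HasRootedTriangle G S a b c) :
    HasRootedTriangle G S a c b := by
  obtain ⟨A, B, C, h, hAB, hAC, hBC⟩ := h
  exact ⟨A, C, B, h.swap, hAC, hAB, hBC.symm⟩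

/-- Move from `B` to `A` everything that `d` separates from `b` inside `B`. -/
lemma IsRootedPartition.shift (h : IsRootedPartition G S a b c A B C) (hd : d ∈ B) (hbd : b ≠ d)
    (hA : Touches G A {d}) :
    IsRootedPartition G S a b c (A ∪ (B \ reachAvoiding G B b d)) (reachAvoiding G B b d) C := by
  have hsub := (reachAvoiding_subset (G := G) h.memB hbd).trans Set.sdiff_subset
  have hdR : d ∉ reachAvoiding G B b d := fun hh => (reachAvoiding_subset h.memB hbd hh).2 rfl
  refine ⟨h.connA.union (h.connB.diff_reachAvoiding h.memB hd hbd)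
      (hA.mono subset_rfl (by rintro _ rfl; exact ⟨hd, hdR⟩)), isConnSet_reachAvoiding, h.connC,
    Or.inl h.memA, mem_reachAvoiding_self, h.memC, ?_, ?_, h.disjBC.mono_left hsub, ?_⟩
  · exact (h.disjAB.mono_right hsub).union_left Set.disjoint_sdiff_left
  · exact h.disjAC.union_left (h.disjBC.mono_left Set.sdiff_subset)
  · rw [← h.union, Set.union_assoc A, Set.sdiff_union_of_subset hsub]

/-- A vertex other than `d` in the middle part is touched by `A`. -/
lemma IsRootedPartition.exists_adj_middle (h : IsRootedPartition G S a b c A B C)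
    (hAC : ¬ Touches G A C) (hd : d ∈ B) (hS : IsConnSet G (S \ {d})) :
    ∃ v ∈ B, v ≠ d ∧ Touches G A {v} := by
  have hdA : d ∉ A := fun hh => Set.disjoint_left.1 h.disjAB hh hd
  have hdC : d ∉ C := fun hh => Set.disjoint_left.1 h.disjBC hd hh
  obtain ⟨u, hu, v, ⟨⟨hvS, hvd⟩, hvA⟩, huv⟩ := hS.2 A
    (fun z hz => ⟨h.union ▸ Or.inl (Or.inl hz), fun hh => hdA (hh ▸ hz)⟩) ⟨a, h.memA⟩
    ⟨c, ⟨h.union ▸ Or.inr h.memC, fun hh => hdC (hh ▸ h.memC)⟩,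
      fun hh => Set.disjoint_left.1 h.disjAC hh h.memC⟩
  rw [← h.union] at hvS
  rcases hvS with (hv | hv) | hv
  · exact absurd hv hvA
  · exact ⟨v, hv, hvd, u, hu, v, rfl, huv⟩
  · exact absurd ⟨u, hu, v, hv, huv⟩ hAC

/-- The shift strictly shrinks `B`, since `d` leaves it. If the enlarged `A` still misses `C`,
induction applies; if it touches `C`, the only thing that can prevent a triangle is that `C` misses
the shrunken `B`. -/
lemma IsRootedPartition.not_touches_of_shift [Finite V] (h : IsRootedPartition G S a b c A B C)
    (ih : ∀ A' B' C', B'.ncard < B.ncard → IsRootedPartition G S a b c A' B' C' →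
      ¬ Touches G A' C' → HasRootedTriangle G S a b c)
    (hno : ¬ HasRootedTriangle G S a b c) (hd : d ∈ B) (hbd : b ≠ d) (hA : Touches G A {d}) :
    ¬ Touches G C (reachAvoiding G B b d) := by
  intro hC
  have h' := h.shift hd hbd hA
  by_cases hAC : Touches G (A ∪ (B \ reachAvoiding G B b d)) C
  · exact hno ⟨_, _, _, h', ((h.connB.touches_reachAvoiding h.memB hd hbd).symm.mono
      Set.subset_union_right subset_rfl), hAC, hC.symm⟩
  · refine hno (ih _ _ _ (Set.ncard_lt_ncard ?_) h' hAC)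
    have hsub := reachAvoiding_subset (G := G) h.memB hbd
    exact ⟨hsub.trans Set.sdiff_subset, fun hh => (hsub (hh hd)).2 rfl⟩

/-- Induction on the size of the middle part `B`, through which alone `A` and `C` are linked.
Without a triangle, shifting towards either side forces every attachment of `A` and of `C` in `B`
other than `b` to be one common vertex, which contradicts connectedness after one deletion. -/
lemma hasRootedTriangle_of_not_touches [Finite V] (hS : ∀ v, IsConnSet G (S \ {v})) :
    ∀ (n : ℕ) (A B C : Set V), B.ncard = n → IsRootedPartition G S a b c A B C →
      ¬ Touches G A C → HasRootedTriangle G S a b c := by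
  intro n
  induction n using Nat.strong_induction_on with
  | _ n ih =>
    intro A B C hn h hAC
    by_contra hno
    have hCA : ¬ Touches G C A := fun hh => hAC hh.symm
    have key : ∀ d ∈ B, b ≠ d → Touches G A {d} → ¬ Touches G C (reachAvoiding G B b d) :=
      fun d hd hbd => h.not_touches_of_shift
        (fun A' B' C' hlt => ih _ (hn ▸ hlt) A' B' C' rfl) hno hd hbd
    have key' : ∀ d ∈ B, b ≠ d → Touches G C {d} → ¬ Touches G A (reachAvoiding G B b d) :=
      fun d hd hbd => h.reverse.not_touches_of_shift
        (fun A' B' C' hlt h' hn' => (ih _ (hn ▸ hlt) C' B' A' rfl h'.reverse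
          (fun hh => hn' hh.symm)).reverse) (fun hh => hno hh.reverse) hd hbd
    have hroot : ∀ {v}, ({b} : Set V) ⊆ reachAvoiding G B b v := by
      rintro v _ rfl
      exact mem_reachAvoiding_self
    have huniq : ∀ d ∈ B, ∀ e ∈ B, b ≠ d → b ≠ e → Touches G A {d} → Touches G C {e} → d = e := by
      intro d hd e he hbd hbe hdA heC
      by_contra hde
      rcases h.connB.mem_reachAvoiding_or h.memB hd hbd hde with hm | hm
      · exact key d hd hbd hdA (heC.mono subset_rfl (Set.singleton_subset_iff.2 hm))
      · exact key' e he hbe heC (hdA.mono subset_rfl (Set.singleton_subset_iff.2 hm))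
    -- Deleting `b` yields an attachment `e ≠ b` of `C`; deleting `e` then yields an attachment `v ≠
    -- e` of `A`. Both `v = b` and `v ≠ b` are excluded.
    obtain ⟨e, he, heb, heC⟩ := h.reverse.exists_adj_middle hCA h.memB (hS b)
    obtain ⟨v, hv, hve, hvA⟩ := h.exists_adj_middle hAC he (hS e)
    by_cases hvb : v = b
    · subst hvb
      exact key' e he heb.symm heC (hvA.mono subset_rfl hroot)
    · exact hve (huniq v hv e he (Ne.symm hvb) heb.symm hvA heC)

/-- A set that stays connected after deleting any one vertex has a triangle minor rooted at any
three of its vertices. -/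
lemma hasRootedTriangle [Finite V] (hS : ∀ v, IsConnSet G (S \ {v})) (ha : a ∈ S) (hb : b ∈ S)
    (hc : c ∈ S) (hab : a ≠ b) (hac : a ≠ c) (hbc : b ≠ c) : HasRootedTriangle G S a b c := by
  have hb' : b ∈ S \ {a} := ⟨hb, hab.symm⟩
  have hc' : c ∈ S \ {a} := ⟨hc, hac.symm⟩
  have hsub := (reachAvoiding_subset (G := G) hb' hbc).trans Set.sdiff_subset
  have hcR : c ∉ reachAvoiding G (S \ {a}) b c := fun hh => (reachAvoiding_subset hb' hbc hh).2 rfl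
  have h : IsRootedPartition G S a b c {a} (reachAvoiding G (S \ {a}) b c)
      ((S \ {a}) \ reachAvoiding G (S \ {a}) b c) := by
    refine ⟨isConnSet_singleton G a, isConnSet_reachAvoiding,
      (hS a).diff_reachAvoiding hb' hc' hbc, rfl, mem_reachAvoiding_self, ⟨hc', hcR⟩, ?_, ?_,
      Set.disjoint_sdiff_right, ?_⟩
    · exact Set.disjoint_singleton_left.2 fun hh => (hsub hh).2 rfl
    · exact Set.disjoint_singleton_left.2 fun hh => hh.1.2 rfl
    · rw [Set.union_assoc, Set.union_sdiff_cancel hsub,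
        Set.union_sdiff_cancel (Set.singleton_subset_iff.2 ha)]
  by_cases hAC : Touches G {a} ((S \ {a}) \ reachAvoiding G (S \ {a}) b c)
  · by_cases hAB : Touches G {a} (reachAvoiding G (S \ {a}) b c)
    · exact ⟨_, _, _, h, hAB, hAC, (hS a).touches_reachAvoiding hb' hc' hbc⟩
    -- The swap makes the part touched by `a` the middle one.
    · exact (hasRootedTriangle_of_not_touches hS _ _ _ _ rfl h.swap hAB).swap
  · exact hasRootedTriangle_of_not_touches hS _ _ _ _ rfl h hAC

end rooted

/-! ### Assembling the `K₄`-model -/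

/-- Four disjoint connected pairwise touching sets covering the vertices give a `K₄`-model. -/
lemma exists_isModel_K₄ {G : SimpleGraph V} (P : Fin 4 → Set V) (hP : ∀ i, IsConnSet G (P i))
    (hcov : ∀ v, ∃ i, v ∈ P i) (hdisj : ∀ i j, i < j → Disjoint (P i) (P j))
    (htouch : ∀ i j, i < j → Touches G (P i) (P j)) :
    ∃ g : V → Fin 4, IsModel G K₄ g ∧ ∀ v i, v ∈ P i → g v = i := by
  choose g hg using hcov
  have huniq : ∀ v i, v ∈ P i → g v = i := by
    intro v i hv
    rcases lt_trichotomy (g v) i with h | h | h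
    · exact absurd hv (Set.disjoint_left.1 (hdisj _ _ h) (hg v))
    · exact h
    · exact absurd (hg v) (Set.disjoint_left.1 (hdisj _ _ h) hv)
  refine ⟨g, ⟨fun i => ?_, fun i j hij => ?_⟩, huniq⟩
  · have hset : {v | g v = i} = P i := by
      ext v
      exact ⟨fun h => h ▸ hg v, huniq v i⟩
    unfold branchSet
    rw [← isConnSet_iff, hset]
    exact hP i
  · have ht : Touches G (P i) (P j) := by
      rcases lt_or_gt_of_ne hij.ne with h | h
      · exact htouch i j h
      · exact (htouch j i h).symm
    obtain ⟨u, hu, v, hv, huv⟩ := ht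
    exact ⟨u, v, huniq u i hu, huniq v j hv, huv⟩

/-- In a `k`-connected graph every vertex has a neighbour outside any set of fewer than `k`
vertices. -/
lemma IsKConnected.exists_adj_notMem [Fintype V] {G : SimpleGraph V} {k : ℕ}
    (hG : IsKConnected k G) (x : V) (T : Finset V) (hT : T.card < k) (hx : x ∉ T) :
    ∃ v, v ∉ T ∧ G.Adj x v := by
  classical
  have hcard : (insert x T).card < Fintype.card V :=
    (Finset.card_insert_le _ _).trans_lt (by have := hG.1; omega)
  obtain ⟨w, hw⟩ : ∃ w, w ∉ insert x T := by
    by_contra! hall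
    rw [Finset.eq_univ_of_forall hall, Finset.card_univ] at hcard
    exact hcard.false
  rw [Finset.mem_insert, not_or] at hw
  obtain ⟨u, hu, v, ⟨hv, -⟩, huv⟩ := (isConnSet_iff.2 (hG.2 T hT)).2 {x}
    (Set.singleton_subset_iff.2 hx) ⟨x, rfl⟩ ⟨w, hw.2, hw.1⟩
  rw [Set.mem_singleton_iff] at hu
  exact ⟨v, hv, hu ▸ huv⟩

/-- In a `4`-connected graph every edge lies inside a branch set of some `K₄`-model. -/
lemma IsKConnected.exists_isModel_K₄_of_adj [Fintype V] {G : SimpleGraph V}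
    (hG : IsKConnected 4 G) {x y : V} (hxy : G.Adj x y) :
    ∃ g : V → Fin 4, IsModel G K₄ g ∧ g x = g y := by
  classical
  obtain ⟨a, ha, hxa⟩ := hG.exists_adj_notMem x {y} (by simp) (by simpa using hxy.ne)
  have ha' : a ≠ y := by simpa using ha
  obtain ⟨b, hb, hxb⟩ := hG.exists_adj_notMem x {y, a}
    (Finset.card_le_two.trans_lt (by norm_num)) (by simp [hxy.ne, hxa.ne])
  have hb' : b ≠ y ∧ b ≠ a := by simpa using hb
  obtain ⟨c, hc, hxc⟩ := hG.exists_adj_notMem x {y, a, b}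
    (Finset.card_le_three.trans_lt (by norm_num)) (by simp [hxy.ne, hxa.ne, hxb.ne])
  have hc' : c ≠ y ∧ c ≠ a ∧ c ≠ b := by simpa using hc
  -- Only `x`, `y` and `v` are deleted, at most three vertices, which 4-connectivity allows.
  have hS : ∀ v, IsConnSet G ({x, y}ᶜ \ {v}) := by
    intro v
    have h := isConnSet_iff.2
      (hG.2 {x, y, v} (Finset.card_le_three.trans_lt (by norm_num)))
    convert h using 1
    ext z
    simp
    tauto
  obtain ⟨A, B, C, h, hAB, hAC, hBC⟩ := hasRootedTriangle (a := a) (b := b) (c := c) hS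
    (by simp [hxa.ne', ha']) (by simp [hxb.ne', hb'.1]) (by simp [hxc.ne', hc'.1])
    hb'.2.symm hc'.2.1.symm hc'.2.2.symm
  have hdisj : Disjoint ({x, y} : Set V) (A ∪ B ∪ C) := h.union ▸ disjoint_compl_right
  rw [Set.disjoint_union_right, Set.disjoint_union_right] at hdisj
  have hxmem : x ∈ ({x, y} : Set V) := Or.inl rfl
  obtain ⟨g, hg, hgP⟩ := exists_isModel_K₄ (G := G) ![{x, y}, A, B, C]
    (by
      intro i
      fin_cases i
      · exact (isConnSet_singleton G x).union (isConnSet_singleton G y) ⟨x, rfl, y, rfl, hxy⟩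
      · exact h.connA
      · exact h.connB
      · exact h.connC)
    (by
      intro v
      by_cases hv : v ∈ ({x, y} : Set V)
      · exact ⟨0, hv⟩
      · have hv' : v ∈ A ∪ B ∪ C := h.union ▸ hv
        rcases hv' with (hv | hv) | hv
        · exact ⟨1, hv⟩
        · exact ⟨2, hv⟩
        · exact ⟨3, hv⟩)
    (by
      intro i j hij
      fin_cases i <;> fin_cases j <;> first
        | exact absurd hij (by decide)
        | exact hdisj.1.1
        | exact hdisj.1.2
        | exact hdisj.2
        | exact h.disjAB
        | exact h.disjAC
        | exact h.disjBC)
    (by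
      intro i j hij
      fin_cases i <;> fin_cases j <;> first
        | exact absurd hij (by decide)
        | exact ⟨x, hxmem, a, h.memA, hxa⟩
        | exact ⟨x, hxmem, b, h.memB, hxb⟩
        | exact ⟨x, hxmem, c, h.memC, hxc⟩
        | exact hAB
        | exact hAC
        | exact hBC)
  exact ⟨g, hg, (hgP x 0 hxmem).trans (hgP y 0 (Or.inr rfl)).symm⟩

end MinorReconfiguration

theorem mainTheorem5 {V : Type*} [Fintype V] (G : SimpleGraph V)
    (hconn : MinorReconfiguration.IsKConnected 4 G)
    (hhost : G ∈ MinorReconfiguration.host MinorReconfiguration.K₄)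
    (hcard : 5 ≤ Fintype.card V)
    (f : MinorReconfiguration.Model G MinorReconfiguration.K₄) (x y : V)
    (hxy : MinorReconfiguration.IsEssentialEdge f x y) :
    ∃ g : MinorReconfiguration.Model G MinorReconfiguration.K₄,
      MinorReconfiguration.Reconfigurable f g ∧ g.label x = g.label y := by
  obtain ⟨g, hg, hgxy⟩ := hconn.exists_isModel_K₄_of_adj hxy.1
  exact ⟨⟨g, hg⟩, hhost.preconnected f ⟨g, hg⟩, hgxy⟩
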